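/- **The problem.** Let $\zeta=(\zeta_1,\dots,\zeta_N)$ be a random vector with independent components, $\zeta_n$ uniformly distributed on $\Gamma_n\subset\mathbb R$, with law $\rho$. Let $U,V$ be real Hilbert spaces ($V$ separable), $e(\cdot,\zeta):V\to V^*$, $\phi\in V^*$, $B:U\to V^*$ bounded linear, $\nu>0$. Let $u\in U$ be the unique solution of the optimal control problem $$\min_{u\in U}\ \mathbb E[F(y(\zeta))]+\tfrac{\nu}{2}\|u\|_U^2,\qquad \langle e(y(\zeta),\zeta),v\rangle=\langle\phi+Bu,v\rangle\quad\forall v\in V,\ \rho\text{-a.e. }\zeta,$$ where $y\in L^p_\rho(V)$ and $F(y)\in L^q_\rho(\mathbb R)$ for some $p,q\ge1$. For multi-indices $\alpha\in\mathbb N_+^D$ ($D\ge1$), $\beta\in\mathbb N_+^N$, let $u^{\alpha,\beta}$ be the unique solution of the fully discrete problem, in which $U,V$ are replaced by finite-dimensional subspaces $U^\alpha,V^\alpha$, $\mathbb E$ by a tensor product quadrature formula of level $\beta$ with nodes in $\Gamma_1\times\cdots\times\Gamma_N$, and the state equation is imposed at the quadrature nodes. Put $u^{\alpha,\beta}=0$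 if a component of $\alpha$ or $\beta$ is zero, and define the hierarchical surpluses and, for finite $\mathcal I\subset\mathbb N_+^{D+N}$, the combination technique approximation $$\boldsymbol\Delta[u^{\alpha,\beta}]=\sum_{i\in\{0,1\}^D}\sum_{j\in\{0,1\}^N}(-1)^{|i|+|j|}u^{\alpha-i,\beta-j},\qquad \mathcal M_{\mathcal I}=\sum_{(\alpha,\beta)\in\mathcal I}\boldsymbol\Delta[u^{\alpha,\beta}].$$ Set $\mathrm{Error}[\mathcal M_{\mathcal I}]=\|u-\mathcal M_{\mathcal I}\|_U$ and $\mathrm{Work}[\mathcal M_{\mathcal I}]=\sum_{(\alpha,\beta)\in\mathcal I}\boldsymbol\Delta W_{\alpha,\beta}$, where $\boldsymbol\Delta W_{\alpha,\beta}$ is the cost of adding $\boldsymbol\Delta[u^{\alpha,\beta}]$. **Assumptions.** $u^{\alpha,\beta}\to u$ in $U$ as all components of $(\alpha,\beta)$ tend to infinity, and there are rates $\widetilde r_n,\widetilde\gamma_n>0$ ($1\le n\le D$), $\widetilde g_n>0$ ($1\le n\le N$) and constants $C_{\rm work},C_{\rm error}$ such that for all $(\alpha,\beta)\in\mathbb N_+^{D+N}$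 $$\boldsymbol\Delta W_{\alpha,\beta}\le C_{\rm work}\prod_{n=1}^D2^{\alpha_n\widetilde\gamma_n}\prod_{n=1}^N(\beta_n+1),\qquad \|\boldsymbol\Delta[u^{\alpha,\beta}]\|_U\le C_{\rm error}\prod_{n=1}^D2^{-\alpha_n\widetilde r_n}\prod_{n=1}^Ne^{-\widetilde g_n(\beta_n+1)}.$$ **Notation.** Let $r_n=\log(2)\widetilde r_n$, $\gamma_n=\log(2)\widetilde\gamma_n$, $\Theta_n=\frac{\gamma_n}{r_n+\gamma_n}$ ($1\le n\le D$), $\mu=\min_n\frac{r_n}{\gamma_n}$, $\chi=\max_n\Theta_n$, $\mathfrak n=\#\{n:\Theta_n=\chi\}$, and $$\mathcal I(L)=\Big\{(\alpha,\beta)\in\mathbb N_+^{D+N}:\ \sum_{n=1}^D(r_n+\gamma_n)\alpha_n+\sum_{n=1}^N\widetilde g_n(\beta_n+1)+\sum_{n=1}^N\log(\beta_n+1)\le L\Big\}.$$ **Theorem.** There is a constant $C_W>0$, depending only on $D$, $N$, the rates and $C_{\rm work}$, such that, with $$L(W_{\max})=\frac1\chi\Big(\log\frac{W_{\max}}{C_W}-(\mathfrak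 n-1)\log\Big(\frac1\chi\log\frac{W_{\max}}{C_W}\Big)\Big),$$ one has $\mathrm{Work}[\mathcal M_{\mathcal I(L(W_{\max}))}]\le W_{\max}$ for every $W_{\max}\ge C_We^{\chi}$, and $$\limsup_{W_{\max}\to\infty}\frac{\mathrm{Error}[\mathcal M_{\mathcal I(L(W_{\max}))}]}{W_{\max}^{-\mu}\,(\log W_{\max})^{(\mu+1)(\mathfrak n-1)}}=C<\infty .$$ -/

import Mathlib

open MeasureTheory Filter Topology
open scoped ENNReal NNReal BigOperators

noncomputable section

namespace CombTech

/-! ### The optimal control problem under uncertainty -/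

/-- Data of an optimal control problem constrained by a random PDE in weak form, with `N` random
parameters, control space `U` and state space `V`.  The pairing `⟨e(y, ζ), v⟩` is `e y ζ v`; the
quantity of interest of a random state `y` is the random variable `ζ ↦ F ζ (y ζ)`. -/
structure RandomOCP (N : ℕ) (U V : Type*)
    [NormedAddCommGroup U] [InnerProductSpace ℝ U]
    [NormedAddCommGroup V] [InnerProductSpace ℝ V] where
  /-- ranges of the random parameters -/
  Γ : Fin N → Set ℝ
  measurableSet_Γ : ∀ n, MeasurableSet (Γ n)
  volume_Γ_ne_zero : ∀ n, volume (Γ n) ≠ 0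
  volume_Γ_ne_top : ∀ n, volume (Γ n) ≠ ∞
  /-- integrability exponent of the states -/
  p : ℝ≥0∞
  one_le_p : 1 ≤ p
  /-- integrability exponent of the quantity of interest -/
  q : ℝ≥0∞
  one_le_q : 1 ≤ q
  /-- the (possibly nonlinear) PDE operator -/
  e : V → (Fin N → ℝ) → StrongDual ℝ V
  /-- the deterministic source term -/
  φ : StrongDual ℝ V
  /-- the control operator -/
  B : U →L[ℝ] StrongDual ℝ V
  /-- the quantity of interest -/
  F : (Fin N → ℝ) → V → ℝ
  /-- the weight of the penalization of the control -/
  ν : ℝ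
  ν_pos : 0 < ν

variable {N : ℕ} {U V : Type*}
  [NormedAddCommGroup U] [InnerProductSpace ℝ U]
  [NormedAddCommGroup V] [InnerProductSpace ℝ V]

namespace RandomOCP

/-- The law of the random vector: independent components, the `n`-th uniform on `Γ n`. -/
def ρ (P : RandomOCP N U V) : Measure (Fin N → ℝ) :=
  Measure.pi fun n => ProbabilityTheory.cond volume (P.Γ n)

/-- `y` is a state associated with the control `u`: it lies in the Bochner space `L^p_ρ(Γ; V)`, its
quantity of interest lies in `L^q_ρ(Γ; ℝ)`, and it solves the state equation almost surely. -/
def IsState (P : RandomOCP N U V) (u : U) (y : (Fin N → ℝ) → V) : Prop :=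
  MemLp y P.p P.ρ ∧ MemLp (fun ζ => P.F ζ (y ζ)) P.q P.ρ ∧
    ∀ᵐ ζ ∂P.ρ, ∀ v : V, P.e (y ζ) ζ v = (P.φ + P.B u) v

/-- The objective `𝔼[F(y)] + (ν / 2) ‖u‖²`. -/
def cost (P : RandomOCP N U V) (u : U) (y : (Fin N → ℝ) → V) : ℝ :=
  (∫ ζ, P.F ζ (y ζ) ∂P.ρ) + P.ν / 2 * ‖u‖ ^ 2

/-- `u` is an optimal control. -/
def IsOptimal (P : RandomOCP N U V) (u : U) : Prop :=
  ∃ y, P.IsState u y ∧ ∀ u' y', P.IsState u' y' → P.cost u y ≤ P.cost u' y'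

/-- `u` is the unique solution of the optimal control problem. -/
def IsSolution (P : RandomOCP N U V) (u : U) : Prop :=
  P.IsOptimal u ∧ ∀ u', P.IsOptimal u' → u' = u

end RandomOCP

/-! ### Its discretization -/

/-- A family of discretizations of `P`: quadrature formulae with `m b` nodes at level `b` for each
random parameter, and finite-dimensional spaces of controls and states indexed by the
spatial multi-index `α`. -/
structure Discretization (P : RandomOCP N U V) (D : ℕ) where
  /-- level-to-nodes map -/
  m : ℕ → ℕ
  strictMono_m : StrictMono m
  /-- nodes of the one-dimensional quadrature formulae -/
  node : Fin N → (b : ℕ) → Fin (m b) → ℝ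
  node_mem : ∀ j b k, node j b k ∈ P.Γ j
  /-- weights of the one-dimensional quadrature formulae -/
  weight : Fin N → (b : ℕ) → Fin (m b) → ℝ
  /-- discrete control spaces -/
  ctrl : (Fin D → ℕ) → Submodule ℝ U
  finiteDimensional_ctrl : ∀ α, FiniteDimensional ℝ (ctrl α)
  /-- discrete state spaces -/
  state : (Fin D → ℕ) → Submodule ℝ V
  finiteDimensional_state : ∀ α, FiniteDimensional ℝ (state α)

namespace Discretization

variable {P : RandomOCP N U V} {D : ℕ}

/-- The nodes of the tensorized quadrature formula of level `β`. -/
def point (T : Discretization P D) (β : Fin N → ℕ) (k : (j : Fin N) → Fin (T.m (β j))) :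
    Fin N → ℝ :=
  fun j => T.node j (β j) (k j)

/-- The tensorized quadrature formula of level `β`. -/
def quad (T : Discretization P D) (β : Fin N → ℕ) (f : (Fin N → ℝ) → ℝ) : ℝ :=
  ∑ k : (j : Fin N) → Fin (T.m (β j)), (∏ j, T.weight j (β j) (k j)) * f (T.point β k)

/-- `y` is a discrete state associated with the control `u`: at each quadrature node, it lies in
the discrete state space and solves the Galerkin equations. -/
def IsState (T : Discretization P D) (α : Fin D → ℕ) (β : Fin N → ℕ) (u : U)
    (y : (Fin N → ℝ) → V) : Prop :=
  ∀ k, y (T.point β k) ∈ T.state α ∧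
    ∀ v ∈ T.state α, P.e (y (T.point β k)) (T.point β k) v = (P.φ + P.B u) v

/-- The fully discrete objective. -/
def cost (T : Discretization P D) (β : Fin N → ℕ) (u : U) (y : (Fin N → ℝ) → V) : ℝ :=
  T.quad β (fun ζ => P.F ζ (y ζ)) + P.ν / 2 * ‖u‖ ^ 2

/-- `u` is an optimal control of the fully discrete problem of level `(α, β)`. -/
def IsOptimal (T : Discretization P D) (α : Fin D → ℕ) (β : Fin N → ℕ) (u : U) : Prop :=
  u ∈ T.ctrl α ∧ ∃ y, T.IsState α β u y ∧
    ∀ u' ∈ T.ctrl α, ∀ y', T.IsState α β u' y' → T.cost β u y ≤ T.cost β u' y'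

/-- `u` is the unique solution of the fully discrete problem of level `(α, β)`. -/
def IsSolution (T : Discretization P D) (α : Fin D → ℕ) (β : Fin N → ℕ) (u : U) : Prop :=
  T.IsOptimal α β u ∧ ∀ u', T.IsOptimal α β u' → u' = u

end Discretization

/-! ### Hierarchical surpluses and the combination technique -/

/-- Multi-indices with all components at least `1`. -/
def IsPos {d : ℕ} (α : Fin d → ℕ) : Prop := ∀ i, 1 ≤ α i

/-- The multi-index `α - 1_S`. -/
def shift {d : ℕ} (α : Fin d → ℕ) (S : Finset (Fin d)) : Fin d → ℕ :=
  fun i => if i ∈ S then α i - 1 else α i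

open Classical in
/-- The convention `u^{α, β} = 0` whenever a component of `α` or `β` vanishes. -/
def zeroExt {D : ℕ} (w : (Fin D → ℕ) → (Fin N → ℕ) → U) (α : Fin D → ℕ) (β : Fin N → ℕ) : U :=
  if IsPos α ∧ IsPos β then w α β else 0

/-- The deterministic hierarchical surplus `∑_{j ∈ {0,1}^D} (-1)^{|j|} w^{α - j, β}`. -/
def detSurplus {D : ℕ} (w : (Fin D → ℕ) → (Fin N → ℕ) → U) (α : Fin D → ℕ) (β : Fin N → ℕ) : U :=
  ∑ S : Finset (Fin D), (-1 : ℝ) ^ S.card • w (shift α S) β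

/-- The stochastic hierarchical surplus `∑_{j ∈ {0,1}^N} (-1)^{|j|} w^{α, β - j}`. -/
def stocSurplus {D : ℕ} (w : (Fin D → ℕ) → (Fin N → ℕ) → U) (α : Fin D → ℕ) (β : Fin N → ℕ) : U :=
  ∑ S : Finset (Fin N), (-1 : ℝ) ^ S.card • w α (shift β S)

/-- The mixed hierarchical surplus `Δ^stoc[Δ^det[w^{α, β}]]`. -/
def surplus {D : ℕ} (w : (Fin D → ℕ) → (Fin N → ℕ) → U) : (Fin D → ℕ) → (Fin N → ℕ) → U :=
  stocSurplus (detSurplus (zeroExt w))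

/-- The combination technique approximation associated with a finite set of multi-indices. -/
def combination {D : ℕ} (w : (Fin D → ℕ) → (Fin N → ℕ) → U)
    (I : Finset ((Fin D → ℕ) × (Fin N → ℕ))) : U :=
  ∑ x ∈ I, surplus w x.1 x.2

/-- The work of the combination technique, when adding the hierarchical surplus of
multi-index `(α, β)` costs `ΔW α β`. -/
def work {D : ℕ} (ΔW : (Fin D → ℕ) → (Fin N → ℕ) → ℝ)
    (I : Finset ((Fin D → ℕ) × (Fin N → ℕ))) : ℝ :=
  ∑ x ∈ I, ΔW x.1 x.2

/-! ### Rates and the quasi-optimal index set -/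

/-- The positive rates: `r'` (spatial error), `γ'` (spatial work), `g` (stochastic error). -/
structure Rates (D N : ℕ) where
  r' : Fin D → ℝ
  γ' : Fin D → ℝ
  g : Fin N → ℝ
  r'_pos : ∀ n, 0 < r' n
  γ'_pos : ∀ n, 0 < γ' n
  g_pos : ∀ n, 0 < g n

namespace Rates

variable {D : ℕ}

/-- The multiplicative bound on the work contributions, without its constant. -/
def workBound (R : Rates D N) (α : Fin D → ℕ) (β : Fin N → ℕ) : ℝ :=
  (∏ n, (2 : ℝ) ^ ((α n : ℝ) * R.γ' n)) * ∏ n, ((β n : ℝ) + 1)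

/-- The multiplicative bound on the error contributions, without its constant. -/
def errorBound (R : Rates D N) (α : Fin D → ℕ) (β : Fin N → ℕ) : ℝ :=
  (∏ n, (2 : ℝ) ^ (-(α n : ℝ) * R.r' n)) * ∏ n, Real.exp (-R.g n * ((β n : ℝ) + 1))

/-- `r = log(2) r'` -/
def r (R : Rates D N) (n : Fin D) : ℝ := Real.log 2 * R.r' n

/-- `γ = log(2) γ'` -/
def γ (R : Rates D N) (n : Fin D) : ℝ := Real.log 2 * R.γ' n

/-- `Θ_n = γ_n / (r_n + γ_n)` -/
def Θ (R : Rates D N) (n : Fin D) : ℝ := R.γ n / (R.r n + R.γ n)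

/-- `μ = min_n r_n / γ_n` -/
def μ (R : Rates D N) : ℝ := ⨅ n, R.r n / R.γ n

/-- `χ = max_n Θ_n` -/
def χ (R : Rates D N) : ℝ := ⨆ n, R.Θ n

open Classical in
/-- The number of indices `n` with `Θ_n = χ`. -/
def mult (R : Rates D N) : ℕ := (Finset.univ.filter fun n => R.Θ n = R.χ).card

/-- The set of multi-indices `(α, β)` with positive components such that
`(r + γ) · α + g · (β + 1) + |log (β + 1)|₁ ≤ L`. -/
def indexSet' (R : Rates D N) (L : ℝ) : Set ((Fin D → ℕ) × (Fin N → ℕ)) :=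
  {x | IsPos x.1 ∧ IsPos x.2 ∧
    ∑ n, (R.r n + R.γ n) * (x.1 n : ℝ) + ∑ n, R.g n * ((x.2 n : ℝ) + 1)
      + ∑ n, Real.log ((x.2 n : ℝ) + 1) ≤ L}

theorem indexSet'_finite (R : Rates D N) (L : ℝ) : (R.indexSet' L).Finite := by
  have hlog : (0 : ℝ) < Real.log 2 := Real.log_pos (by norm_num)
  have hc : ∀ n, 0 < R.r n + R.γ n := fun n =>
    add_pos (mul_pos hlog (R.r'_pos n)) (mul_pos hlog (R.γ'_pos n))
  refine ((Set.finite_Icc (0 : Fin D → ℕ) (fun n => ⌊L / (R.r n + R.γ n)⌋₊)).prod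
    (Set.finite_Icc (0 : Fin N → ℕ) (fun n => ⌊L / R.g n⌋₊))).subset ?_
  rintro ⟨α, β⟩ ⟨-, -, h⟩
  dsimp only at h
  have h1 : ∀ n, 0 ≤ (R.r n + R.γ n) * (α n : ℝ) := fun n =>
    mul_nonneg (hc n).le (Nat.cast_nonneg _)
  have h2 : ∀ n, 0 ≤ R.g n * ((β n : ℝ) + 1) := fun n =>
    mul_nonneg (R.g_pos n).le (by positivity)
  have h3 : 0 ≤ ∑ n, Real.log ((β n : ℝ) + 1) := Finset.sum_nonneg fun n _ =>
    Real.log_nonneg (by linarith [Nat.cast_nonneg (α := ℝ) (β n)])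
  have s1 : 0 ≤ ∑ n, (R.r n + R.γ n) * (α n : ℝ) := Finset.sum_nonneg fun n _ => h1 n
  have s2 : 0 ≤ ∑ n, R.g n * ((β n : ℝ) + 1) := Finset.sum_nonneg fun n _ => h2 n
  refine ⟨⟨fun _ => Nat.zero_le _, fun n => Nat.le_floor ?_⟩,
    ⟨fun _ => Nat.zero_le _, fun n => Nat.le_floor ?_⟩⟩
  · rw [le_div_iff₀ (hc n)]
    have := Finset.single_le_sum (fun i _ => h1 i) (Finset.mem_univ n)
    linarith
  · rw [le_div_iff₀ (R.g_pos n)]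
    have := Finset.single_le_sum (fun i _ => h2 i) (Finset.mem_univ n)
    linarith [R.g_pos n]

/-- The a-priori index set `I(L)`. -/
def indexSet (R : Rates D N) (L : ℝ) : Finset ((Fin D → ℕ) × (Fin N → ℕ)) :=
  (R.indexSet'_finite L).toFinset

/-- The level `L(W)` chosen for the work budget `W`. -/
def level (R : Rates D N) (C W : ℝ) : ℝ :=
  1 / R.χ * (Real.log (W / C) - ((R.mult : ℝ) - 1) * Real.log (1 / R.χ * Real.log (W / C)))

end Rates

end CombTech

end

namespace CombTech

/-! ### Exponential sums over simplices. -/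

open Finset

/-! Error and work contributions are linked by `errorBound = workBound * exp (-weight)`, and `I(L)`
is the sublevel set `weight ≤ L` (`errorBound_eq`). One estimate therefore drives everything: the
total of `workBound` over `I(M)` is at most `K e^{χM} (1+M)^{𝔫-1}` (`exists_sum_workBound_le`).

For that estimate, put `x_n = (r_n + γ_n) α_n`, so that the spatial work is `exp (∑ Θ_n x_n)`,
summed over a simplex in `x`. The exponent is at most `χ ∑ x_n`. Summing along a direction with `Θ_j
= χ` gives a geometric sum of size `e^{χM}`. Each other direction contributes a bounded factor if
`Θ_n < χ` and `O(1+M)` if `Θ_n = χ`, whence the power `𝔫-1`. The stochastic indices shrink the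
simplex by enough to give a convergent series.

For the error, surpluses telescope over boxes, so `u - M_I` is a limit of sums of surpluses outside
`I(L)`. Cutting the complement into unit layers of the weight and applying the work estimate in each
layer gives `K e^{-(1-χ)L} (1+L)^{𝔫-1}` (`exists_sum_errorBound_le`).

Finally `L(W)` nearly inverts the work estimate: with `l = log(W/C_W)/χ`, `e^{χL} l^{𝔫-1} = W/C_W`.
The relation `μχ = 1-χ` turns the error bound into `W^{-μ} (log W)^{(μ+1)(𝔫-1)}`. -/

theorem sum_exp_le_of_le {χ c s M : ℝ} (hχ : 0 < χ) (hc : 0 < c) (F : Finset ℕ)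
    (hF : ∀ a ∈ F, c * (a : ℝ) + s ≤ M) :
    ∑ a ∈ F, Real.exp (χ * (c * (a : ℝ) + s)) ≤
      (1 - Real.exp (-(χ * c)))⁻¹ * Real.exp (χ * M) := by
  have hq0 : 0 ≤ Real.exp (-(χ * c)) := (Real.exp_pos _).le
  have hq1 : Real.exp (-(χ * c)) < 1 := Real.exp_lt_one_iff.2 (by nlinarith)
  rcases F.eq_empty_or_nonempty with rfl | hne
  · simp only [sum_empty]
    have : 0 < 1 - Real.exp (-(χ * c)) := by linarith
    positivity
  -- The sum is dominated by its largest term, at `k`; the terms decay geometrically in `k - a`.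
  set k := F.max' hne
  have hk : c * (k : ℝ) + s ≤ M := hF k (F.max'_mem hne)
  have hle : ∀ a ∈ F, a ≤ k := fun a ha => F.le_max' a ha
  calc ∑ a ∈ F, Real.exp (χ * (c * (a : ℝ) + s))
      ≤ ∑ a ∈ F, Real.exp (-(χ * c)) ^ (k - a) * Real.exp (χ * M) := by
        refine sum_le_sum fun a ha => ?_
        rw [← Real.exp_nat_mul, ← Real.exp_add, Nat.cast_sub (hle a ha)]
        refine Real.exp_le_exp.2 ?_
        nlinarith
    _ = (∑ i ∈ F.image (fun a => k - a), Real.exp (-(χ * c)) ^ i) * Real.exp (χ * M) := by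
        rw [← sum_mul, sum_image]
        intro a ha b hb hab
        have h1 := hle a ha
        have h2 := hle b hb
        dsimp only at hab
        omega
    _ ≤ _ := by
        refine mul_le_mul_of_nonneg_right ?_ (Real.exp_pos _).le
        rw [← tsum_geometric_of_lt_one hq0 hq1]
        exact (summable_geometric_of_lt_one hq0 hq1).sum_le_tsum _ fun i _ => pow_nonneg hq0 i

/-- The dichotomy behind the logarithms: a direction with strict decay contributes a convergent
geometric series, a direction tied with the maximum contributes its number of terms. -/
theorem exists_sum_exp_neg_le (δ c : ℝ) (hc : 0 < c) (hδ : 0 ≤ δ) :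
    ∃ K : ℝ, 0 < K ∧ ∀ M : ℝ, 0 ≤ M → ∑ a ∈ Icc 1 ⌊M / c⌋₊, Real.exp (-(δ * (a : ℝ))) ≤
      K * (1 + M) ^ (if δ = 0 then 1 else 0) := by
  split_ifs with h
  · subst h
    refine ⟨1 / c, by positivity, fun M hM => ?_⟩
    simp only [zero_mul, neg_zero, Real.exp_zero, sum_const, Nat.card_Icc, add_tsub_cancel_right,
      nsmul_eq_mul, mul_one, pow_one]
    refine (Nat.floor_le (by positivity)).trans ?_
    rw [div_mul_eq_mul_div, one_mul]
    gcongr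
    linarith
  · have hδ' : 0 < δ := lt_of_le_of_ne hδ (Ne.symm h)
    have hq0 : 0 ≤ Real.exp (-δ) := (Real.exp_pos _).le
    have hq1 : Real.exp (-δ) < 1 := Real.exp_lt_one_iff.2 (by linarith)
    refine ⟨(1 - Real.exp (-δ))⁻¹, inv_pos.2 (by linarith), fun M _ => ?_⟩
    rw [pow_zero, mul_one, ← tsum_geometric_of_lt_one hq0 hq1]
    refine le_trans (le_of_eq (sum_congr rfl fun a _ => ?_))
      ((summable_geometric_of_lt_one hq0 hq1).sum_le_tsum _ fun i _ => pow_nonneg hq0 i)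
    rw [← Real.exp_nat_mul]
    ring_nf

/-- Factor the summand as `exp (χ ∑ c_n α_n)` times the decay `∏ exp (-(χ - θ_n) c_n α_n)`. Summing
over `α_j` first exhausts the exponential; the other coordinates range over a box and decouple. The
bounds `M'` and `M` are separate so that, for simplices shrinking with `β`, the polynomial factor
stays uniform. -/
theorem exists_sum_exp_simplex_le {ι : Type*} [Fintype ι] [DecidableEq ι] (c θ : ι → ℝ) {χ : ℝ}
    (hc : ∀ n, 0 < c n) (hχ : 0 < χ) (hθ : ∀ n, θ n ≤ χ) (j : ι) (hj : θ j = χ) :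
    ∃ K : ℝ, 0 < K ∧ ∀ M M' : ℝ, 0 ≤ M → M' ≤ M → ∀ F : Finset (ι → ℕ),
      (∀ α ∈ F, (∀ n, 1 ≤ α n) ∧ ∑ n, c n * (α n : ℝ) ≤ M') →
      ∑ α ∈ F, Real.exp (∑ n, θ n * (c n * (α n : ℝ))) ≤
        K * Real.exp (χ * M') * (1 + M) ^ (#{n | θ n = χ} - 1) := by
  choose k hk0 hk using fun n => exists_sum_exp_neg_le ((χ - θ n) * c n) (c n) (hc n)
    (mul_nonneg (sub_nonneg.2 (hθ n)) (hc n).le)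
  have hq1 : Real.exp (-(χ * c j)) < 1 := Real.exp_lt_one_iff.2 (by nlinarith [mul_pos hχ (hc j)])
  refine ⟨(1 - Real.exp (-(χ * c j)))⁻¹ * ∏ n ∈ univ.erase j, k n,
    mul_pos (inv_pos.2 (by linarith)) (prod_pos fun n _ => hk0 n), fun M M' hM hMM' F hF => ?_⟩
  set d : ι → ℕ → ℝ := fun n a => Real.exp (-((χ - θ n) * c n * (a : ℝ))) with hd
  -- Fibres along direction `j` are labelled by `α` with its `j`-th entry reset to `0`. That entry
  -- costs nothing because `d j` is identically `1`.
  set box : ι → Finset ℕ := fun n => if n = j then {0} else Icc 1 ⌊M / c n⌋₊ with hbox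
  have hsplit : ∀ α : ι → ℕ, ∑ n, c n * (α n : ℝ) =
      c j * (α j : ℝ) + ∑ n ∈ univ.erase j, c n * (α n : ℝ) := fun α =>
    (add_sum_erase univ (fun n => c n * (α n : ℝ)) (mem_univ j)).symm
  have hfact : ∀ α : ι → ℕ, Real.exp (∑ n, θ n * (c n * (α n : ℝ))) =
      Real.exp (χ * ∑ n, c n * (α n : ℝ)) * ∏ n, d n (α n) := fun α => by
    rw [hd, ← Real.exp_sum, ← Real.exp_add, mul_sum, ← sum_add_distrib]
    congr 1
    exact sum_congr rfl fun n _ => by ring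
  have hmaps : ∀ α ∈ F, Function.update α j 0 ∈ Fintype.piFinset box := fun α hα => by
    rw [Fintype.mem_piFinset]
    intro n
    by_cases hn : n = j
    · subst hn; simp [hbox]
    · simp only [hbox, hn, if_false, Function.update_of_ne hn, mem_Icc]
      refine ⟨(hF α hα).1 n, Nat.le_floor ?_⟩
      rw [le_div_iff₀ (hc n), mul_comm]
      refine le_trans ?_ ((hF α hα).2.trans hMM')
      exact single_le_sum (f := fun n => c n * (α n : ℝ))
        (fun i _ => mul_nonneg (hc i).le (Nat.cast_nonneg _)) (mem_univ n)
  have hfiber : ∀ y ∈ Fintype.piFinset box,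
      ∑ α ∈ F with Function.update α j 0 = y, Real.exp (∑ n, θ n * (c n * (α n : ℝ))) ≤
        (1 - Real.exp (-(χ * c j)))⁻¹ * Real.exp (χ * M') * ∏ n, d n (y n) := fun y _ => by
    have hother : ∀ α ∈ F.filter (fun α => Function.update α j 0 = y), ∀ n, n ≠ j → α n = y n := by
      intro α hα n hn
      rw [← (mem_filter.1 hα).2, Function.update_of_ne hn]
    set s := ∑ n ∈ univ.erase j, c n * (y n : ℝ) with hs
    have hS : ∀ α ∈ F.filter (fun α => Function.update α j 0 = y),
        ∑ n, c n * (α n : ℝ) = c j * (α j : ℝ) + s := fun α hα => by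
      rw [hsplit, hs]
      congr 1
      exact sum_congr rfl fun n hn => by rw [hother α hα n (ne_of_mem_erase hn)]
    have hP : ∀ α ∈ F.filter (fun α => Function.update α j 0 = y),
        ∏ n, d n (α n) = ∏ n, d n (y n) := fun α hα => by
      refine prod_congr rfl fun n _ => ?_
      by_cases hn : n = j
      · subst hn; simp [hd, hj]
      · rw [hother α hα n hn]
    have hinj : Set.InjOn (fun α : ι → ℕ => α j)
        (F.filter (fun α => Function.update α j 0 = y) : Finset (ι → ℕ)) := by
      intro α hα α' hα' h
      funext n
      by_cases hn : n = j
      · subst hn; exact h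
      · rw [hother α hα n hn, hother α' hα' n hn]
    calc _ = ∑ α ∈ F with Function.update α j 0 = y,
          Real.exp (χ * (c j * (α j : ℝ) + s)) * ∏ n, d n (y n) :=
          sum_congr rfl fun α hα => by rw [hfact, hS α hα, hP α hα]
      _ = (∑ a ∈ (F.filter (fun α => Function.update α j 0 = y)).image (fun α : ι → ℕ => α j),
            Real.exp (χ * (c j * (a : ℝ) + s))) * ∏ n, d n (y n) := by
          rw [← sum_mul, sum_image hinj]
      _ ≤ _ := by
          refine mul_le_mul_of_nonneg_right (sum_exp_le_of_le hχ (hc j) _ ?_)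
            (prod_nonneg fun n _ => (Real.exp_pos _).le)
          intro a ha
          obtain ⟨α, hα, rfl⟩ := mem_image.1 ha
          rw [← hS α hα]
          exact (hF α (mem_filter.1 hα).1).2
  have hcoord : ∏ n, ∑ a ∈ box n, d n a ≤
      (∏ n ∈ univ.erase j, k n) * (1 + M) ^ (#{n | θ n = χ} - 1) := by
    rw [← mul_prod_erase univ _ (mem_univ j)]
    have h1 : ∑ a ∈ box j, d j a = 1 := by simp [hbox, hd]
    have hcard : ∏ n ∈ univ.erase j, (1 + M) ^ (if (χ - θ n) * c n = 0 then 1 else 0) =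
        (1 + M) ^ (#{n | θ n = χ} - 1) := by
      rw [prod_pow_eq_pow_sum, sum_boole, Nat.cast_id,
        ← card_erase_of_mem (show j ∈ univ.filter (fun n => θ n = χ) by simp [hj])]
      congr 2
      ext n
      simp only [mem_filter, mem_erase, mem_univ, and_true, true_and, mul_eq_zero,
        (hc n).ne', or_false, sub_eq_zero]
      exact and_congr_right fun _ => eq_comm
    rw [h1, one_mul, ← hcard, ← prod_mul_distrib]
    refine prod_le_prod (fun n _ => sum_nonneg fun a _ => (Real.exp_pos _).le) fun n hn => ?_
    simp only [hbox, ne_of_mem_erase hn, if_false]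
    exact hk n M hM
  rw [← sum_fiberwise_of_maps_to hmaps]
  refine (sum_le_sum hfiber).trans ?_
  rw [← mul_sum, ← prod_univ_sum box d]
  have hpos : 0 ≤ (1 - Real.exp (-(χ * c j)))⁻¹ * Real.exp (χ * M') :=
    mul_nonneg (inv_nonneg.2 (by linarith)) (Real.exp_pos _).le
  refine (mul_le_mul_of_nonneg_left hcoord hpos).trans (le_of_eq (by ring))

theorem summable_mul_exp_neg {b : ℝ} (hb : 0 < b) (k m : ℕ) :
    Summable fun n : ℕ => ((n : ℝ) + m) ^ k * Real.exp (-b * ((n : ℝ) + m)) := by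
  simpa using (summable_nat_add_iff m).2 (Real.summable_pow_mul_exp_neg_nat_mul k hb)

/-! ### The rates, the weight, and sums over its sublevel sets and their complements. -/

namespace Rates

variable {D N : ℕ}

theorem r_pos (R : Rates D N) (n : Fin D) : 0 < R.r n :=
  mul_pos (Real.log_pos one_lt_two) (R.r'_pos n)

theorem γ_pos (R : Rates D N) (n : Fin D) : 0 < R.γ n :=
  mul_pos (Real.log_pos one_lt_two) (R.γ'_pos n)

theorem Θ_mul (R : Rates D N) (n : Fin D) : R.Θ n * (R.r n + R.γ n) = R.γ n :=
  div_mul_cancel₀ _ (add_pos (R.r_pos n) (R.γ_pos n)).ne'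

theorem Θ_le_χ (R : Rates D N) (n : Fin D) : R.Θ n ≤ R.χ :=
  le_ciSup (Set.finite_range _).bddAbove n

theorem exists_Θ_eq_χ (hD : 0 < D) (R : Rates D N) : ∃ n, R.Θ n = R.χ := by
  have : Nonempty (Fin D) := ⟨⟨0, hD⟩⟩
  exact exists_eq_ciSup_of_finite

theorem χ_pos (hD : 0 < D) (R : Rates D N) : 0 < R.χ := by
  obtain ⟨n, hn⟩ := exists_Θ_eq_χ hD R
  rw [← hn]
  exact div_pos (R.γ_pos n) (add_pos (R.r_pos n) (R.γ_pos n))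

theorem χ_lt_one (hD : 0 < D) (R : Rates D N) : R.χ < 1 := by
  obtain ⟨n, hn⟩ := exists_Θ_eq_χ hD R
  rw [← hn, Θ, div_lt_one (add_pos (R.r_pos n) (R.γ_pos n))]
  linarith [R.r_pos n]

theorem one_le_mult (hD : 0 < D) (R : Rates D N) : 1 ≤ R.mult := by
  obtain ⟨n, hn⟩ := exists_Θ_eq_χ hD R
  exact card_pos.2 ⟨n, by simp [hn]⟩

/-- Since `r_n / γ_n = 1 / Θ_n - 1` decreases in `Θ_n`, the minimum `μ` is attained where `Θ_n` is
maximal. -/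
theorem μ_mul_χ (hD : 0 < D) (R : Rates D N) : R.μ * R.χ = 1 - R.χ := by
  have : Nonempty (Fin D) := ⟨⟨0, hD⟩⟩
  have key : ∀ n, R.r n / R.γ n = 1 / R.Θ n - 1 := fun n => by
    have h1 := R.r_pos n
    have h2 := R.γ_pos n
    rw [Θ]
    field_simp
    ring
  have hΘ : ∀ n, 0 < R.Θ n := fun n => div_pos (R.γ_pos n) (add_pos (R.r_pos n) (R.γ_pos n))
  have h : R.μ = 1 / R.χ - 1 := by
    obtain ⟨j, hj⟩ := exists_Θ_eq_χ hD R
    apply le_antisymm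
    · rw [← hj, ← key]
      exact ciInf_le (Set.finite_range _).bddBelow j
    · refine le_ciInf fun n => ?_
      rw [key]
      have := one_div_le_one_div_of_le (hΘ n) (R.Θ_le_χ n)
      linarith
  rw [h]
  have := (R.χ_pos hD).ne'
  field_simp

theorem μ_nonneg (hD : 0 < D) (R : Rates D N) : 0 ≤ R.μ := by
  have : Nonempty (Fin D) := ⟨⟨0, hD⟩⟩
  exact le_ciInf fun n => (div_pos (R.r_pos n) (R.γ_pos n)).le

/-- The weighted length of a multi-index whose sublevel sets are the index sets. -/
noncomputable def weight (R : Rates D N) (α : Fin D → ℕ) (β : Fin N → ℕ) : ℝ :=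
  ∑ n, (R.r n + R.γ n) * (α n : ℝ) + ∑ n, R.g n * ((β n : ℝ) + 1)
      + ∑ n, Real.log ((β n : ℝ) + 1)

theorem mem_indexSet (R : Rates D N) {L : ℝ} {x : (Fin D → ℕ) × (Fin N → ℕ)} :
    x ∈ R.indexSet L ↔ IsPos x.1 ∧ IsPos x.2 ∧ R.weight x.1 x.2 ≤ L := by
  rw [indexSet, Set.Finite.mem_toFinset]
  rfl

theorem weight_pos (hD : 0 < D) (R : Rates D N) {α : Fin D → ℕ} (hα : IsPos α) (β : Fin N → ℕ) :
    0 < R.weight α β := by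
  have : Nonempty (Fin D) := ⟨⟨0, hD⟩⟩
  have h1 : 0 < ∑ n, (R.r n + R.γ n) * (α n : ℝ) :=
    sum_pos (fun n _ => mul_pos (add_pos (R.r_pos n) (R.γ_pos n))
      (by exact_mod_cast hα n)) univ_nonempty
  have h2 : 0 ≤ ∑ n, R.g n * ((β n : ℝ) + 1) :=
    sum_nonneg fun n _ => mul_nonneg (R.g_pos n).le (by positivity)
  have h3 : 0 ≤ ∑ n, Real.log ((β n : ℝ) + 1) :=
    sum_nonneg fun n _ => Real.log_nonneg (by linarith [Nat.cast_nonneg (α := ℝ) (β n)])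
  unfold weight
  linarith

theorem indexSet_eq_empty (hD : 0 < D) (R : Rates D N) {L : ℝ} (hL : L ≤ 0) :
    R.indexSet L = ∅ := by
  refine eq_empty_of_forall_notMem fun x hx => ?_
  obtain ⟨h1, -, h3⟩ := R.mem_indexSet.1 hx
  linarith [R.weight_pos hD h1 x.2]

theorem workBound_eq (R : Rates D N) (α : Fin D → ℕ) (β : Fin N → ℕ) :
    R.workBound α β = Real.exp (∑ n, R.γ n * (α n : ℝ)) * ∏ n, ((β n : ℝ) + 1) := by
  rw [workBound, Real.exp_sum]
  congr 1
  refine prod_congr rfl fun n _ => ?_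
  rw [Real.rpow_def_of_pos two_pos, γ]
  ring_nf

theorem workBound_pos (R : Rates D N) (α : Fin D → ℕ) (β : Fin N → ℕ) : 0 < R.workBound α β := by
  rw [workBound_eq]
  exact mul_pos (Real.exp_pos _) (prod_pos fun n _ => by positivity)

theorem errorBound_eq (R : Rates D N) (α : Fin D → ℕ) (β : Fin N → ℕ) :
    R.errorBound α β = R.workBound α β * Real.exp (-R.weight α β) := by
  have h : ∏ n, ((β n : ℝ) + 1) = Real.exp (∑ n, Real.log ((β n : ℝ) + 1)) := by
    rw [Real.exp_sum]
    exact prod_congr rfl fun n _ => (Real.exp_log (by positivity)).symm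
  have h' : ∏ n, (2 : ℝ) ^ (-(α n : ℝ) * R.r' n) = Real.exp (∑ n, -(R.r n * (α n : ℝ))) := by
    rw [Real.exp_sum]
    refine prod_congr rfl fun n _ => ?_
    rw [Real.rpow_def_of_pos two_pos, r]
    ring_nf
  rw [errorBound, workBound_eq, h, h', ← Real.exp_sum, ← Real.exp_add, ← Real.exp_add,
    ← Real.exp_add, weight]
  congr 1
  simp only [add_mul, sum_add_distrib, sum_neg_distrib, neg_mul]
  ring

theorem errorBound_pos (R : Rates D N) (α : Fin D → ℕ) (β : Fin N → ℕ) :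
    0 < R.errorBound α β := by
  rw [errorBound_eq]
  exact mul_pos (R.workBound_pos α β) (Real.exp_pos _)

/-- For fixed `β` the admissible `α` fill a simplex of size `M - b β`, so the simplex estimate gains
`exp (-χ b β)`. This beats the stochastic work `∏ (β_n + 1)` and makes the sum over `β` converge. -/
theorem exists_sum_workBound_le (hD : 0 < D) (R : Rates D N) :
    ∃ K : ℝ, 0 < K ∧ ∀ M : ℝ, 0 ≤ M → ∑ x ∈ R.indexSet M, R.workBound x.1 x.2 ≤
      K * Real.exp (R.χ * M) * (1 + M) ^ (R.mult - 1) := by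
  classical
  obtain ⟨j, hj⟩ := exists_Θ_eq_χ hD R
  have hχ := R.χ_pos hD
  obtain ⟨K, hK, hKle⟩ := exists_sum_exp_simplex_le (fun n => R.r n + R.γ n) R.Θ
    (fun n => add_pos (R.r_pos n) (R.γ_pos n)) hχ R.Θ_le_χ j hj
  have hmult : R.mult = #{n | R.Θ n = R.χ} := by
    unfold mult
    congr
  rw [← hmult] at hKle
  set b : (Fin N → ℕ) → ℝ := fun β =>
    ∑ n, R.g n * ((β n : ℝ) + 1) + ∑ n, Real.log ((β n : ℝ) + 1) with hb
  have hb0 : ∀ β, 0 ≤ b β := fun β => add_nonneg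
    (sum_nonneg fun n _ => mul_nonneg (R.g_pos n).le (by positivity))
    (sum_nonneg fun n _ => Real.log_nonneg (by linarith [Nat.cast_nonneg (α := ℝ) (β n)]))
  set t : Fin N → ℕ → ℝ := fun n k =>
    ((k : ℝ) + 1) * Real.exp (-(R.χ * R.g n) * ((k : ℝ) + 1)) with ht
  have ht0 : ∀ n k, 0 ≤ t n k := fun n k => by simp only [ht]; positivity
  have hts : ∀ n, Summable (t n) := fun n => by
    simpa [ht] using summable_mul_exp_neg (mul_pos hχ (R.g_pos n)) 1 1
  have htpos : ∀ n, 0 < ∑' k, t n k := fun n =>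
    (hts n).tsum_pos (ht0 n) 0 (by simp only [ht]; positivity)
  refine ⟨K * ∏ n, ∑' k, t n k, mul_pos hK (prod_pos fun n _ => htpos n), fun M hM => ?_⟩
  have hfiber : ∀ β ∈ (R.indexSet M).image Prod.snd,
      ∑ x ∈ R.indexSet M with x.2 = β, R.workBound x.1 x.2 ≤
        K * Real.exp (R.χ * M) * (1 + M) ^ (R.mult - 1) * ∏ n, t n (β n) := fun β _ => by
    have hinj : Set.InjOn (Prod.fst : (Fin D → ℕ) × (Fin N → ℕ) → _)
        ((R.indexSet M).filter (fun x => x.2 = β) : Finset _) := by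
      intro x hx y hy h
      exact Prod.ext h ((mem_filter.1 hx).2.trans (mem_filter.1 hy).2.symm)
    -- Only the part of `b β` linear in `β` is needed; the logarithms are nonnegative and are
    -- dropped.
    have hexp : Real.exp (R.χ * (M - b β)) * ∏ n, ((β n : ℝ) + 1) ≤
        Real.exp (R.χ * M) * ∏ n, t n (β n) := by
      rw [ht, prod_mul_distrib, ← Real.exp_sum, mul_left_comm, ← Real.exp_add, mul_comm]
      refine mul_le_mul_of_nonneg_left (Real.exp_le_exp.2 ?_) (prod_nonneg fun n _ => by positivity)
      have h3 : 0 ≤ ∑ n, Real.log ((β n : ℝ) + 1) :=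
        sum_nonneg fun n _ => Real.log_nonneg (by linarith [Nat.cast_nonneg (α := ℝ) (β n)])
      have h4 : ∑ n, -(R.χ * R.g n) * ((β n : ℝ) + 1) =
          -(R.χ * ∑ n, R.g n * ((β n : ℝ) + 1)) := by
        rw [mul_sum, ← sum_neg_distrib]
        exact sum_congr rfl fun n _ => by ring
      rw [h4, hb]
      nlinarith [mul_nonneg hχ.le h3]
    calc _ = ∑ x ∈ R.indexSet M with x.2 = β,
          Real.exp (∑ n, R.Θ n * ((R.r n + R.γ n) * (x.1 n : ℝ))) * ∏ n, ((β n : ℝ) + 1) := by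
          refine sum_congr rfl fun x hx => ?_
          rw [workBound_eq, (mem_filter.1 hx).2]
          congr 2
          exact sum_congr rfl fun n _ => by rw [← mul_assoc, R.Θ_mul]
      _ = (∑ α ∈ ((R.indexSet M).filter (fun x => x.2 = β)).image Prod.fst,
          Real.exp (∑ n, R.Θ n * ((R.r n + R.γ n) * (α n : ℝ)))) * ∏ n, ((β n : ℝ) + 1) := by
          rw [← sum_mul, sum_image hinj]
      _ ≤ (K * Real.exp (R.χ * (M - b β)) * (1 + M) ^ (R.mult - 1)) * ∏ n, ((β n : ℝ) + 1) := by
          refine mul_le_mul_of_nonneg_right (hKle M _ hM (by linarith [hb0 β]) _ ?_)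
            (prod_nonneg fun n _ => by positivity)
          intro α hα
          obtain ⟨x, hx, rfl⟩ := mem_image.1 hα
          obtain ⟨hxI, hxβ⟩ := mem_filter.1 hx
          obtain ⟨h1, -, h3⟩ := R.mem_indexSet.1 hxI
          refine ⟨h1, ?_⟩
          unfold weight at h3
          rw [hxβ] at h3
          simp only [hb]
          linarith
      _ = K * (1 + M) ^ (R.mult - 1) *
          (Real.exp (R.χ * (M - b β)) * ∏ n, ((β n : ℝ) + 1)) := by ring
      _ ≤ K * (1 + M) ^ (R.mult - 1) * (Real.exp (R.χ * M) * ∏ n, t n (β n)) :=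
          mul_le_mul_of_nonneg_left hexp (by positivity)
      _ = _ := by ring
  rw [← sum_fiberwise_of_maps_to (fun x hx => mem_image_of_mem Prod.snd hx)]
  refine (sum_le_sum hfiber).trans ?_
  rw [← mul_sum]
  have hsum : ∑ β ∈ (R.indexSet M).image Prod.snd, ∏ n, t n (β n) ≤ ∏ n, ∑' k, t n k := by
    set T := (R.indexSet M).image Prod.snd
    calc _ ≤ ∑ β ∈ Fintype.piFinset (fun n => T.image (fun β => β n)), ∏ n, t n (β n) :=
          sum_le_sum_of_subset_of_nonneg
            (fun β hβ => Fintype.mem_piFinset.2 fun n => mem_image_of_mem (fun β => β n) hβ)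
            (fun β _ _ => prod_nonneg fun n _ => ht0 n _)
      _ = ∏ n, ∑ k ∈ T.image (fun β => β n), t n k := (prod_univ_sum _ _).symm
      _ ≤ _ := prod_le_prod (fun n _ => sum_nonneg fun k _ => ht0 n k)
          fun n _ => (hts n).sum_le_tsum _ fun k _ => ht0 n k
  exact (mul_le_mul_of_nonneg_left hsum (by positivity)).trans (le_of_eq (by ring))

/-- Where the weight lies in `[L+k, L+k+1)`, the error is at most the work times `exp (-(L+k))`, and
the work of the layer is at most that of `I(L+k+1)`. As `χ < 1`, the resulting series in `k`
converges. -/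
theorem exists_sum_errorBound_le (hD : 0 < D) (R : Rates D N) :
    ∃ K : ℝ, 0 < K ∧ ∀ L : ℝ, 0 ≤ L → ∀ E : Finset ((Fin D → ℕ) × (Fin N → ℕ)),
      (∀ x ∈ E, IsPos x.1 ∧ IsPos x.2 ∧ x ∉ R.indexSet L) →
      ∑ x ∈ E, R.errorBound x.1 x.2 ≤
        K * Real.exp (-((1 - R.χ) * L)) * (1 + L) ^ (R.mult - 1) := by
  classical
  obtain ⟨K, hK, hKle⟩ := R.exists_sum_workBound_le hD
  have hχ := R.χ_pos hD
  have hχ1 : 0 < 1 - R.χ := sub_pos.2 (R.χ_lt_one hD)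
  set t : ℕ → ℝ := fun k =>
    ((k : ℝ) + 2) ^ (R.mult - 1) * Real.exp (-(1 - R.χ) * ((k : ℝ) + 2)) with ht
  have ht0 : ∀ k, 0 ≤ t k := fun k => by simp only [ht]; positivity
  have hts : Summable t := by simpa [ht] using summable_mul_exp_neg hχ1 (R.mult - 1) 2
  have htpos : 0 < ∑' k, t k := hts.tsum_pos ht0 0 (by simp only [ht]; positivity)
  refine ⟨K * Real.exp (2 - R.χ) * ∑' k, t k, by positivity, fun L hL E hE => ?_⟩
  set f : (Fin D → ℕ) × (Fin N → ℕ) → ℕ := fun x => ⌊R.weight x.1 x.2 - L⌋₊ with hf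
  have hfiber : ∀ k ∈ E.image f, ∑ x ∈ E with f x = k, R.errorBound x.1 x.2 ≤
      K * Real.exp (2 - R.χ) * Real.exp (-((1 - R.χ) * L)) * (1 + L) ^ (R.mult - 1) * t k :=
    fun k _ => by
    have hmem : ∀ x ∈ E.filter (fun x => f x = k),
        L + k ≤ R.weight x.1 x.2 ∧ x ∈ R.indexSet (L + k + 1) := fun x hx => by
      obtain ⟨hxE, hxk⟩ := mem_filter.1 hx
      obtain ⟨h1, h2, h3⟩ := hE x hxE
      have h4 : L < R.weight x.1 x.2 := by
        by_contra! h
        exact h3 (R.mem_indexSet.2 ⟨h1, h2, h⟩)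
      have h5 := Nat.floor_le (sub_nonneg.2 h4.le)
      have h6 := Nat.lt_floor_add_one (R.weight x.1 x.2 - L)
      simp only [hf] at hxk
      rw [hxk] at h5 h6
      exact ⟨by linarith, R.mem_indexSet.2 ⟨h1, h2, by linarith⟩⟩
    calc _ ≤ ∑ x ∈ E with f x = k, R.workBound x.1 x.2 * Real.exp (-(L + k)) := by
          refine sum_le_sum fun x hx => ?_
          rw [errorBound_eq]
          exact mul_le_mul_of_nonneg_left
            (Real.exp_le_exp.2 (neg_le_neg (hmem x hx).1)) (R.workBound_pos _ _).le
      _ = (∑ x ∈ E with f x = k, R.workBound x.1 x.2) * Real.exp (-(L + k)) := (sum_mul ..).symm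
      _ ≤ (∑ x ∈ R.indexSet (L + k + 1), R.workBound x.1 x.2) * Real.exp (-(L + k)) :=
          mul_le_mul_of_nonneg_right (sum_le_sum_of_subset_of_nonneg
            (fun x hx => (hmem x hx).2) fun x _ _ => (R.workBound_pos _ _).le) (Real.exp_pos _).le
      _ ≤ (K * Real.exp (R.χ * (L + k + 1)) * (1 + (L + k + 1)) ^ (R.mult - 1)) *
          Real.exp (-(L + k)) :=
          mul_le_mul_of_nonneg_right (hKle _ (by positivity)) (Real.exp_pos _).le
      _ ≤ (K * Real.exp (R.χ * (L + k + 1)) * ((1 + L) * (k + 2)) ^ (R.mult - 1)) *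
          Real.exp (-(L + k)) := by
          gcongr
          nlinarith [mul_nonneg hL (Nat.cast_nonneg (α := ℝ) k)]
      -- The constant comes from `χ(L+k+1) - (L+k) = (2-χ) - (1-χ)L - (1-χ)(k+2)`.
      _ = K * (Real.exp (R.χ * (L + k + 1)) * Real.exp (-(L + k))) * (1 + L) ^ (R.mult - 1) *
          ((k : ℝ) + 2) ^ (R.mult - 1) := by rw [mul_pow]; ring
      _ = K * (Real.exp (2 - R.χ) * Real.exp (-((1 - R.χ) * L)) *
          Real.exp (-(1 - R.χ) * ((k : ℝ) + 2))) * (1 + L) ^ (R.mult - 1) *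
          ((k : ℝ) + 2) ^ (R.mult - 1) := by
          rw [← Real.exp_add, ← Real.exp_add, ← Real.exp_add]
          ring_nf
      _ = _ := by simp only [ht]; ring
  rw [← sum_fiberwise_of_maps_to (fun x hx => mem_image_of_mem f hx)]
  refine (sum_le_sum hfiber).trans ?_
  rw [← mul_sum]
  refine (mul_le_mul_of_nonneg_left (hts.sum_le_tsum _ fun k _ => ht0 k) (by positivity)).trans
    (le_of_eq (by ring))

end Rates

/-! ### Telescoping of surpluses and the error of the combination technique. -/

/-- Telescoping of the alternating differences of a function on a box. -/
theorem sum_box_alternating {U : Type*} [AddCommGroup U] [Module ℝ U] {d : ℕ}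
    (v : (Fin d → ℕ) → U) (hv : ∀ α, ¬ IsPos α → v α = 0) (A : Fin d → ℕ) :
    ∑ α ∈ Fintype.piFinset (fun n => Icc 1 (A n)),
      ∑ S : Finset (Fin d), (-1 : ℝ) ^ S.card • v (shift α S) = v A := by
  classical
  set box0 : Finset (Fin d → ℕ) := Fintype.piFinset fun n => range (A n + 1) with hbox0
  -- Expanding `v` in point masses, which are products over coordinates, reduces the claim to
  -- one-dimensional telescoping.
  have hexpand : ∀ α ∈ box0, v α = ∑ a ∈ box0, (∏ n, if α n = a n then (1 : ℝ) else 0) • v a := by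
    intro α hα
    rw [sum_eq_single_of_mem α hα]
    · simp
    · intro a _ ha
      obtain ⟨n, hn⟩ := Function.ne_iff.1 ha
      rw [prod_eq_zero (mem_univ n) (by simp [Ne.symm hn]), zero_smul]
  have hmem : ∀ α ∈ Fintype.piFinset (fun n => Icc 1 (A n)), ∀ S, shift α S ∈ box0 := by
    intro α hα S
    rw [hbox0, Fintype.mem_piFinset]
    intro n
    have := mem_Icc.1 (Fintype.mem_piFinset.1 hα n)
    simp only [shift, mem_range]
    split_ifs <;> omega
  have hA : A ∈ box0 := Fintype.mem_piFinset.2 fun n => mem_range.2 (Nat.lt_succ_self _)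
  have hshift : ∀ (α a : Fin d → ℕ), ∑ S : Finset (Fin d),
      (-1 : ℝ) ^ S.card * ∏ n, (if shift α S n = a n then (1 : ℝ) else 0) =
        ∏ n, ((if α n = a n then (1 : ℝ) else 0) - if α n - 1 = a n then 1 else 0) := by
    intro α a
    simp only [sub_eq_neg_add]
    rw [prod_add, powerset_univ]
    refine sum_congr rfl fun S _ => ?_
    rw [prod_neg, ← prod_mul_prod_compl S, compl_eq_univ_sdiff, mul_assoc]
    congr 2
    · exact prod_congr rfl fun n hn => by simp [shift, hn]
    · exact prod_congr rfl fun n hn => by simp [shift, (mem_sdiff.1 hn).2]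
  have htel : ∀ (m k : ℕ), ∑ i ∈ Icc 1 m,
      ((if i = k then (1 : ℝ) else 0) - if i - 1 = k then 1 else 0) =
        (if m = k then 1 else 0) - if 0 = k then 1 else 0 := by
    intro m k
    induction m with
    | zero => simp
    | succ m ih => rw [sum_Icc_succ_top (by omega), ih]; simp
  calc _ = ∑ α ∈ Fintype.piFinset (fun n => Icc 1 (A n)), ∑ S : Finset (Fin d),
        ∑ a ∈ box0, ((-1 : ℝ) ^ S.card * ∏ n, (if shift α S n = a n then (1 : ℝ) else 0)) • v a :=
        sum_congr rfl fun α hα => sum_congr rfl fun S _ => by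
          rw [hexpand _ (hmem α hα S), smul_sum]
          exact sum_congr rfl fun a _ => smul_smul _ _ _
    _ = ∑ a ∈ box0, (∏ n, ((if A n = a n then (1 : ℝ) else 0) - if 0 = a n then 1 else 0)) • v a := by
        rw [sum_congr rfl fun α _ => sum_comm, sum_comm]
        refine sum_congr rfl fun a _ => ?_
        simp only [← sum_smul, hshift]
        rw [← prod_univ_sum (fun n => Icc 1 (A n)) fun n i =>
          ((if i = a n then (1 : ℝ) else 0) - if i - 1 = a n then 1 else 0)]
        simp only [htel]
    -- The boundary terms at `0` only meet values `v a` with a vanishing component of `a`, which are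
    -- zero.
    _ = ∑ a ∈ box0, (∏ n, if A n = a n then (1 : ℝ) else 0) • v a := by
        refine sum_congr rfl fun a _ => ?_
        by_cases ha : IsPos a
        · congr 1
          refine prod_congr rfl fun n _ => ?_
          rw [if_neg (show ¬ 0 = a n by have := ha n; omega), sub_zero]
        · rw [hv a ha, smul_zero, smul_zero]
    _ = v A := (hexpand A hA).symm

variable {N : ℕ} {U : Type*} [NormedAddCommGroup U] [InnerProductSpace ℝ U]

theorem sum_box_surplus {D : ℕ} (w : (Fin D → ℕ) → (Fin N → ℕ) → U) {A : Fin D → ℕ}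
    {B : Fin N → ℕ} (hA : IsPos A) (hB : IsPos B) :
    ∑ x ∈ Fintype.piFinset (fun n => Icc 1 (A n)) ×ˢ Fintype.piFinset (fun n => Icc 1 (B n)),
      surplus w x.1 x.2 = w A B := by
  have h1 : ∀ β, ∑ α ∈ Fintype.piFinset (fun n => Icc 1 (A n)), detSurplus (zeroExt w) α β =
      zeroExt w A β := fun β =>
    sum_box_alternating (fun α => zeroExt w α β) (fun α hα => if_neg fun h => hα h.1) A
  rw [sum_product_right]
  calc _ = ∑ β ∈ Fintype.piFinset (fun n => Icc 1 (B n)),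
        ∑ S : Finset (Fin N), (-1 : ℝ) ^ S.card • zeroExt w A (shift β S) :=
        sum_congr rfl fun β _ => by
          simp only [surplus, stocSurplus]
          rw [sum_comm]
          exact sum_congr rfl fun S _ => by rw [← smul_sum, h1]
    _ = zeroExt w A B :=
        sum_box_alternating (fun β => zeroExt w A β) (fun β hβ => if_neg fun h => hβ h.2) B
    _ = w A B := if_pos ⟨hA, hB⟩

theorem exists_norm_sub_combination_le {D : ℕ} (hD : 0 < D) (R : Rates D N) :
    ∃ K : ℝ, 0 < K ∧ ∀ (u : U) (w : (Fin D → ℕ) → (Fin N → ℕ) → U) (C : ℝ),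
      Tendsto (fun x : (Fin D → ℕ) × (Fin N → ℕ) => w x.1 x.2) atTop (𝓝 u) →
      (∀ α β, IsPos α → IsPos β → ‖surplus w α β‖ ≤ C * R.errorBound α β) →
      0 ≤ C ∧ ∀ L : ℝ, 0 ≤ L → ‖u - combination w (R.indexSet L)‖ ≤
        C * (K * Real.exp (-((1 - R.χ) * L)) * (1 + L) ^ (R.mult - 1)) := by
  classical
  obtain ⟨K, hK, hKle⟩ := R.exists_sum_errorBound_le hD
  refine ⟨K, hK, fun u w C hw hC => ?_⟩
  have hC0 : 0 ≤ C := by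
    have h := (norm_nonneg _).trans
      (hC (fun _ => 1) (fun _ => 1) (fun _ => le_rfl) (fun _ => le_rfl))
    exact nonneg_of_mul_nonneg_left h (R.errorBound_pos _ _)
  refine ⟨hC0, fun L hL => ?_⟩
  refine le_of_tendsto ((hw.sub_const (combination w (R.indexSet L))).norm) ?_
  -- For large `y` the box up to `y` contains `I(L)`, so `w y - M_I` is the sum of the surpluses in
  -- the box outside `I(L)`, bounded uniformly in `y`.
  have hlarge : ∀ᶠ y : (Fin D → ℕ) × (Fin N → ℕ) in atTop,
      (∀ x ∈ R.indexSet L, x ≤ y) ∧ (fun _ => 1, fun _ => 1) ≤ y :=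
    ((R.indexSet L).eventually_all.2 fun x _ => eventually_ge_atTop x).and (eventually_ge_atTop _)
  filter_upwards [hlarge] with y hy
  set box := Fintype.piFinset (fun n => Icc 1 (y.1 n)) ×ˢ Fintype.piFinset (fun n => Icc 1 (y.2 n))
  have hsub : R.indexSet L ⊆ box := fun x hx => by
    obtain ⟨h1, h2, -⟩ := R.mem_indexSet.1 hx
    refine mem_product.2 ⟨Fintype.mem_piFinset.2 fun n => mem_Icc.2 ⟨h1 n, (hy.1 x hx).1 n⟩,
      Fintype.mem_piFinset.2 fun n => mem_Icc.2 ⟨h2 n, (hy.1 x hx).2 n⟩⟩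
  have hbox : ∀ x ∈ box, IsPos x.1 ∧ IsPos x.2 := fun x hx =>
    ⟨fun n => (mem_Icc.1 (Fintype.mem_piFinset.1 (mem_product.1 hx).1 n)).1,
      fun n => (mem_Icc.1 (Fintype.mem_piFinset.1 (mem_product.1 hx).2 n)).1⟩
  rw [← sum_box_surplus w (fun n => hy.2.1 n) (fun n => hy.2.2 n), combination,
    ← sum_sdiff hsub, add_sub_cancel_right]
  refine (norm_sum_le _ _).trans ?_
  refine (sum_le_sum fun x hx => hC x.1 x.2 (hbox x (mem_sdiff.1 hx).1).1
    (hbox x (mem_sdiff.1 hx).1).2).trans ?_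
  rw [← mul_sum]
  refine mul_le_mul_of_nonneg_left (hKle L hL _ fun x hx => ?_) hC0
  obtain ⟨h1, h2⟩ := mem_sdiff.1 hx
  exact ⟨(hbox x h1).1, (hbox x h1).2, h2⟩

end CombTech

namespace CombTech

/-! ### The level attached to a work budget. -/

namespace Rates

variable {D N : ℕ}

theorem level_le (hD : 0 < D) (R : Rates D N) {C W : ℝ} (h : 1 ≤ 1 / R.χ * Real.log (W / C)) :
    R.level C W ≤ 1 / R.χ * Real.log (W / C) := by
  have h1 : (1 : ℝ) ≤ R.mult := by exact_mod_cast R.one_le_mult hD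
  have h2 := mul_nonneg (one_div_pos.2 (R.χ_pos hD)).le
    (mul_nonneg (sub_nonneg.2 h1) (Real.log_nonneg h))
  rw [level, mul_sub]
  linarith

theorem χ_mul_level (hD : 0 < D) (R : Rates D N) (C W : ℝ) :
    R.χ * R.level C W = Real.log (W / C) -
      ((R.mult : ℝ) - 1) * Real.log (1 / R.χ * Real.log (W / C)) := by
  rw [level, ← mul_assoc, mul_one_div_cancel (R.χ_pos hD).ne', one_mul]

theorem exp_χ_mul_level (hD : 0 < D) (R : Rates D N) {C W : ℝ} (hC : 0 < C) (hW : 0 < W)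
    (h : 1 ≤ 1 / R.χ * Real.log (W / C)) :
    Real.exp (R.χ * R.level C W) * (1 / R.χ * Real.log (W / C)) ^ (R.mult - 1) = W / C := by
  set l := 1 / R.χ * Real.log (W / C) with hl
  have hl0 : 0 < l := by linarith
  rw [χ_mul_level hD, ← hl, Real.exp_sub, Real.exp_log (div_pos hW hC)]
  have : Real.exp (((R.mult : ℝ) - 1) * Real.log l) = l ^ (R.mult - 1) := by
    rw [← Nat.cast_pred (R.one_le_mult hD), Real.exp_nat_mul, Real.exp_log hl0]
  rw [this]
  exact div_mul_cancel₀ _ (pow_pos hl0 _).ne'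

theorem tendsto_scaled_log (hD : 0 < D) (R : Rates D N) {C : ℝ} (hC : 0 < C) :
    Tendsto (fun W : ℝ => 1 / R.χ * Real.log (W / C)) atTop atTop :=
  (Real.tendsto_log_atTop.comp (tendsto_id.atTop_div_const hC)).const_mul_atTop
    (one_div_pos.2 (R.χ_pos hD))

theorem eventually_level_nonneg (hD : 0 < D) (R : Rates D N) {C : ℝ} (hC : 0 < C) :
    ∀ᶠ W in atTop, 0 ≤ R.level C W := by
  have hχ := R.χ_pos hD
  have h1 : (0 : ℝ) ≤ (R.mult : ℝ) - 1 := sub_nonneg.2 (by exact_mod_cast R.one_le_mult hD)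
  have ho := (Real.isLittleO_log_id_atTop.bound
    (show 0 < (1 / R.χ * ((R.mult : ℝ) - 1) + 1)⁻¹ by positivity))
  filter_upwards [(R.tendsto_scaled_log hD hC).eventually ho,
    (R.tendsto_scaled_log hD hC).eventually_ge_atTop 1] with W h2 h3
  rw [level]
  set l := 1 / R.χ * Real.log (W / C) with hl
  rw [mul_sub, ← hl, ← mul_assoc, sub_nonneg]
  have hlog := Real.log_nonneg h3
  simp only [id, Real.norm_eq_abs, abs_of_nonneg hlog, abs_of_nonneg (zero_le_one.trans h3)] at h2
  have hA : 0 < 1 / R.χ * ((R.mult : ℝ) - 1) + 1 := by positivity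
  rw [inv_mul_eq_div, le_div_iff₀ hA] at h2
  linarith

/-- Because `1-χ = μχ`, the exponential is the `μ`-th power of `exp (-χL) = (C/W) l^{𝔫-1}`, where `l
= log(W/C)/χ`; the extra factor `l^{𝔫-1}` raises the power of `l` from `μ(𝔫-1)` to `(μ+1)(𝔫-1)`. -/
theorem exp_neg_level_eq (hD : 0 < D) (R : Rates D N) {C W : ℝ} (hC : 0 < C) (hW : 0 < W)
    (h : 1 ≤ 1 / R.χ * Real.log (W / C)) :
    Real.exp (-((1 - R.χ) * R.level C W)) * (1 / R.χ * Real.log (W / C)) ^ (R.mult - 1) =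
      C ^ R.μ * W ^ (-R.μ) *
        (1 / R.χ * Real.log (W / C)) ^ ((R.μ + 1) * ((R.mult : ℝ) - 1)) := by
  have hl0 : 0 < 1 / R.χ * Real.log (W / C) := by linarith
  rw [← R.μ_mul_χ hD, mul_assoc, χ_mul_level hD, ← Real.rpow_natCast,
    Nat.cast_pred (R.one_le_mult hD), Real.rpow_def_of_pos hl0, Real.rpow_def_of_pos hl0,
    Real.rpow_def_of_pos hC, Real.rpow_def_of_pos hW, ← Real.exp_add, ← Real.exp_add,
    ← Real.exp_add, Real.log_div hW.ne' hC.ne']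
  ring_nf

theorem work_indexSet_le (hD : 0 < D) (R : Rates D N) {K C_work C W : ℝ} (hK : 0 < K)
    (hKle : ∀ M : ℝ, 0 ≤ M → ∑ x ∈ R.indexSet M, R.workBound x.1 x.2 ≤
      K * Real.exp (R.χ * M) * (1 + M) ^ (R.mult - 1))
    (hC : 0 < C) (hCK : |C_work| * K * 2 ^ (R.mult - 1) ≤ C)
    {ΔW : (Fin D → ℕ) → (Fin N → ℕ) → ℝ}
    (hΔW : ∀ α β, IsPos α → IsPos β → ΔW α β ≤ C_work * R.workBound α β)
    (hW : C * Real.exp R.χ ≤ W) :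
    work ΔW (R.indexSet (R.level C W)) ≤ W := by
  have hχ := R.χ_pos hD
  have hW0 : 0 < W := (mul_pos hC (Real.exp_pos _)).trans_le hW
  -- The correction `log l` can make the level nonpositive for moderate `W`; the index set is then
  -- empty.
  rcases le_total (R.level C W) 0 with h0 | h0
  · rw [R.indexSet_eq_empty hD h0, work, Finset.sum_empty]
    exact hW0.le
  have hX : R.χ ≤ Real.log (W / C) := by
    rw [Real.le_log_iff_exp_le (div_pos hW0 hC), le_div_iff₀ hC, mul_comm]
    exact hW
  have hl : 1 ≤ 1 / R.χ * Real.log (W / C) := by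
    rw [one_div_mul_eq_div, le_div_iff₀ hχ, one_mul]
    exact hX
  have hle := R.level_le hD hl
  calc work ΔW (R.indexSet (R.level C W))
      ≤ ∑ x ∈ R.indexSet (R.level C W), |C_work| * R.workBound x.1 x.2 := by
        refine Finset.sum_le_sum fun x hx => ?_
        obtain ⟨h1, h2, -⟩ := R.mem_indexSet.1 hx
        exact (hΔW _ _ h1 h2).trans
          (mul_le_mul_of_nonneg_right (le_abs_self _) (R.workBound_pos _ _).le)
    _ ≤ |C_work| * (K * Real.exp (R.χ * R.level C W) * (1 + R.level C W) ^ (R.mult - 1)) := by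
        rw [← Finset.mul_sum]
        exact mul_le_mul_of_nonneg_left (hKle _ h0) (abs_nonneg _)
    -- Since `W ≥ C e^χ` means `l ≥ 1`, and the level is at most `l`, one has `1 + L ≤ 2l`; this is
    -- the source of `2 ^ (𝔫-1)` in `C_W`.
    _ ≤ |C_work| * (K * Real.exp (R.χ * R.level C W) *
          (2 * (1 / R.χ * Real.log (W / C))) ^ (R.mult - 1)) := by
        gcongr
        linarith
    _ = |C_work| * K * 2 ^ (R.mult - 1) * (W / C) := by
        have h := R.exp_χ_mul_level hD hC hW0 hl
        rw [mul_pow]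
        linear_combination |C_work| * K * 2 ^ (R.mult - 1) * h
    _ ≤ C * (W / C) := mul_le_mul_of_nonneg_right hCK (div_pos hW0 hC).le
    _ = W := mul_div_cancel₀ W hC.ne'

theorem exists_eventually_error_le (hD : 0 < D) (R : Rates D N) {C K : ℝ} (hC : 0 < C)
    (hK : 0 ≤ K) {err : ℝ → ℝ}
    (herr : ∀ L, 0 ≤ L → err L ≤ K * Real.exp (-((1 - R.χ) * L)) * (1 + L) ^ (R.mult - 1)) :
    ∃ K' : ℝ, ∀ᶠ W : ℝ in atTop, err (R.level C W) /
      (W ^ (-R.μ) * Real.log W ^ ((R.μ + 1) * ((R.mult : ℝ) - 1))) ≤ K' := by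
  have hχ := R.χ_pos hD
  have hμ := R.μ_nonneg hD
  set s := (R.μ + 1) * ((R.mult : ℝ) - 1) with hs
  have hs0 : 0 ≤ s := mul_nonneg (by linarith)
    (sub_nonneg.2 (by exact_mod_cast R.one_le_mult hD))
  refine ⟨K * 2 ^ (R.mult - 1) * C ^ R.μ * (2 / R.χ) ^ s, ?_⟩
  filter_upwards [R.eventually_level_nonneg hD hC,
    (R.tendsto_scaled_log hD hC).eventually_ge_atTop 1, eventually_gt_atTop 0,
    Real.tendsto_log_atTop.eventually_gt_atTop 0,
    Real.tendsto_log_atTop.eventually_ge_atTop (-Real.log C)] with W h0 hl hW hlog hlogC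
  have hle := R.level_le hD hl
  -- Once `log W ≥ -log C`, `log (W/C) ≤ 2 log W`, which removes `C` from the logarithm.
  have hl2 : 1 / R.χ * Real.log (W / C) ≤ 2 / R.χ * Real.log W := by
    rw [Real.log_div hW.ne' hC.ne', div_mul_eq_mul_div, div_mul_eq_mul_div]
    exact div_le_div_of_nonneg_right (by linarith) hχ.le
  rw [div_le_iff₀ (mul_pos (Real.rpow_pos_of_pos hW _) (Real.rpow_pos_of_pos hlog _))]
  calc err (R.level C W)
      ≤ K * Real.exp (-((1 - R.χ) * R.level C W)) * (1 + R.level C W) ^ (R.mult - 1) := herr _ h0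
    _ ≤ K * Real.exp (-((1 - R.χ) * R.level C W)) *
          (2 * (1 / R.χ * Real.log (W / C))) ^ (R.mult - 1) := by
        gcongr
        linarith
    _ = K * 2 ^ (R.mult - 1) * (C ^ R.μ * W ^ (-R.μ) * (1 / R.χ * Real.log (W / C)) ^ s) := by
        rw [hs, ← R.exp_neg_level_eq hD hC hW hl, mul_pow]
        ring
    _ ≤ K * 2 ^ (R.mult - 1) * (C ^ R.μ * W ^ (-R.μ) * (2 / R.χ * Real.log W) ^ s) := by
        gcongr
    _ = _ := by
        rw [Real.mul_rpow (by positivity) hlog.le]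
        ring

end Rates

end CombTech

/-! ### The complexity theorem. -/

theorem theorem2 {D N : ℕ} (hD : 0 < D) (R : CombTech.Rates D N) (C_work : ℝ) :
    ∃ C_W : ℝ, 0 < C_W ∧
      ∀ (U V : Type*)
        [NormedAddCommGroup U] [InnerProductSpace ℝ U] [CompleteSpace U]
        [NormedAddCommGroup V] [InnerProductSpace ℝ V] [CompleteSpace V]
        [TopologicalSpace.SeparableSpace V]
        (P : CombTech.RandomOCP N U V) (T : CombTech.Discretization P D)
        (u : U) (w : (Fin D → ℕ) → (Fin N → ℕ) → U)
        (ΔW : (Fin D → ℕ) → (Fin N → ℕ) → ℝ) (C_error : ℝ),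
        -- `u` solves the control problem, and `w α β` its discretization of level `(α, β)`
        P.IsSolution u →
        (∀ α β, CombTech.IsPos α → CombTech.IsPos β → T.IsSolution α β (w α β)) →
        -- the full tensor product discretization converges
        Tendsto (fun x : (Fin D → ℕ) × (Fin N → ℕ) => w x.1 x.2) atTop (𝓝 u) →
        -- bounds on the work and error contributions
        (∀ α β, CombTech.IsPos α → CombTech.IsPos β → ΔW α β ≤ C_work * R.workBound α β) →
        (∀ α β, CombTech.IsPos α → CombTech.IsPos β →
          ‖CombTech.surplus w α β‖ ≤ C_error * R.errorBound α β) →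
        (∀ W_max : ℝ, C_W * Real.exp R.χ ≤ W_max →
          CombTech.work ΔW (R.indexSet (R.level C_W W_max)) ≤ W_max) ∧
        ∃ C : ℝ≥0,
          limsup (fun W_max : ℝ => ENNReal.ofReal
            (‖u - CombTech.combination w (R.indexSet (R.level C_W W_max))‖ /
              (W_max ^ (-R.μ) * Real.log W_max ^ ((R.μ + 1) * ((R.mult : ℝ) - 1))))) atTop
            = (C : ℝ≥0∞) := by
  obtain ⟨K, hK, hKle⟩ := R.exists_sum_workBound_le hD
  -- The summand `1` keeps the constant positive even if `C_work = 0`.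
  have hC_W : 0 < |C_work| * K * 2 ^ (R.mult - 1) + 1 := by positivity
  refine ⟨|C_work| * K * 2 ^ (R.mult - 1) + 1, hC_W, ?_⟩
  intro U V _ _ _ _ _ _ _ P T u w ΔW C_error _ _ hw hΔW hsurplus
  refine ⟨fun W hW => R.work_indexSet_le hD hK hKle hC_W (by linarith) hΔW hW, ?_⟩
  obtain ⟨K', hK', hK'le⟩ := CombTech.exists_norm_sub_combination_le (U := U) hD R
  obtain ⟨hC_error, herr⟩ := hK'le u w C_error hw hsurplus
  obtain ⟨K'', hK''⟩ := R.exists_eventually_error_le hD hC_W (mul_nonneg hC_error hK'.le)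
    (err := fun L => ‖u - CombTech.combination w (R.indexSet L)‖)
    (fun L hL => (herr L hL).trans (le_of_eq (by ring)))
  refine ⟨_, (ENNReal.coe_toNNReal (ne_top_of_le_ne_top ENNReal.ofReal_ne_top
    (limsup_le_of_le (a := ENNReal.ofReal K'') isCobounded_le_of_bot ?_))).symm⟩
  filter_upwards [hK''] with W h
  exact ENNReal.ofReal_le_ofReal h
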